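/- **Setting.** Let $\mathrm G=(\mathrm V,\mathrm E)$ be a finite, undirected, connected graph with weights $w_{ij}=w_{ji}>0$ for $(i,j)\in\mathrm E$, $w_{ij}=0$ for $(i,j)\notin\mathrm E$, and $\sum_{j\in\mathrm V} w_{ij}<1$ for all $i\in\mathrm V$. Consider the average consensus algorithm $$x_i(t+1)=x_i(t)+u_i(t),\qquad u_i(t)=\sum_{j\in \mathrm V}w_{ij}\bigl(y_j(t)-y_i(t)\bigr),\qquad y_i(t)=x_i(t)+\gamma_i(t),$$ with states $x_i(t)$, publicly observed messages $y_i(t)$ and noise $\gamma_i(t)=\sigma_i\eta_i$ for all $t\ge 0$, where $(\eta_i)_{i\in \mathrm V}$ are independent real random variables. For $T\ge 1$ running steps write $\mathbf x=(x_i(t))_{i\in \mathrm V,\,0\le t\le T-1}$ for the stacked node state trajectories. Given the public inputs $\mathbf b=(u_i(t))_{i\in\mathrm V,\,0\le t\le T-2}$ they lie on the affine manifold $\mathcal C_d=\{\mathbf x:\mathbf D\mathbf x+\mathbf b=0\}$, where $\mathbf D$ is block diagonal with one $(T-1)\times T$ block per node, whose rows are $(0,\dots,0,1,-1,0,\dots,0)$;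 that is, $x_i(t)-x_i(t+1)+u_i(t)=0$. **Adjacency.** Let $\mathbf D$ have $q$ rows. Points $\mathbf x,\mathbf x'\in\mathcal C_d$ are manifold $\mu$-adjacent if there are a set $\mathrm d$ of $q$ coordinates for which the square submatrix $\mathbf D_{\mathrm d}$ of the columns in $\mathrm d$ is nonsingular, and a coordinate $k\notin \mathrm d$, such that $|x_k-x'_k|\le\mu$, $x_l=x'_l$ for all $l\notin \mathrm d\cup\{k\}$, and $\mathbf x_{\mathrm d}-\mathbf x'_{\mathrm d}=-\mathbf D_{\mathrm d}^{-1}\mathbf D_{-\mathrm d}(\mathbf x_{-\mathrm d}-\mathbf x'_{-\mathrm d})$, where $-\mathrm d$ is the complement of $\mathrm d$. **Calibration.** Let $\Phi$ be the standard normal distribution function, $\kappa(x,y)=\Phi\bigl(\tfrac y2-\tfrac xy\bigr)-e^{x}\Phi\bigl(-\tfrac y2-\tfrac xy\bigr)$, let $\kappa_x^{-1}$ be the inverse of $y\mapsto\kappa(x,y)$ on $(0,\infty)$, and $\kappa_x^{-2}(\delta)=(\kappa_x^{-1}(\delta))^2$. Let $\mathcal L(0,1)$ be the Laplace distribution with density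 $\tfrac12e^{-|v|}$. **Theorem.** Let $\epsilon,\mu>0$ and let either of the following hold: (i) (Gaussian) $0<\delta<1$, $\eta_i\sim\mathcal N(0,1)$ and $\sigma_i^2\ge\mu^2/\kappa_\epsilon^{-2}(\delta)$ for all $i\in \mathrm V$; (ii) (Laplace) $\delta=0$, $\eta_i\sim\mathcal L(0,1)$ and $\sigma_i\ge\mu/\epsilon$ for all $i\in \mathrm V$. Then the algorithm preserves $(\epsilon,\delta)$-differential privacy of all node state trajectories under manifold $\mu$-adjacency. That is, for every $T\ge1$: (a) for every $\mathbf b$, the mechanism $\mathscr M(\mathbf x)=(x_i(t)+\gamma_i(t))_{i\in \mathrm V,\,0\le t\le T-1}$ satisfies $\mathbb P(\mathscr M(\mathbf x)\in R)\le e^{\epsilon}\,\mathbb P(\mathscr M(\mathbf x')\in R)+\delta$ for all manifold $\mu$-adjacent $\mathbf x,\mathbf x'\in\mathcal C_d$ and all measurable $R$; (b) the same inequality holds when $\mathscr M(\mathbf x)$ is the vector of all messages $y_i(t)$, $i\in\mathrm V$, $0\le t\le T-1$, produced by actually running the algorithm from the initial states $x_i(0)$ of $\mathbf x$, for all manifold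 $\mu$-adjacent $\mathbf x,\mathbf x'\in\mathcal C_d$ whose inputs $\mathbf b$ are those computed from a common message record $(y_i(t))_{i\in\mathrm V,\,0\le t\le T-1}$. -/

import Mathlib

open MeasureTheory ProbabilityTheory

namespace AffineDP

noncomputable section

/-! ### Noise distributions and calibration function -/

/-- The Laplace distribution with mean `m` and scale `s` (variance `2 * s ^ 2`, for `0 < s`). -/
def laplaceMeasure (m s : ℝ) : Measure ℝ :=
  (volume : Measure ℝ).withDensity
    (fun v => ENNReal.ofReal ((2 * s)⁻¹ * Real.exp (-|v - m| / s)))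

/-- The standard normal cumulative distribution function. -/
def Phi (v : ℝ) : ℝ := cdf (gaussianReal 0 1) v

/-- `κ(x, y) = Φ(y/2 - x/y) - e^x Φ(-y/2 - x/y)`. -/
def kappa (x y : ℝ) : ℝ :=
  Phi (y / 2 - x / y) - Real.exp x * Phi (-(y / 2) - x / y)

/-- `κ_x⁻¹`, the inverse of the map `y ↦ κ(x, y)` on `(0, ∞)`. -/
def kappaInv (x d : ℝ) : ℝ := Function.invFunOn (kappa x) (Set.Ioi 0) d

/-! ### Differential privacy over affine manifolds -/

section Manifold

variable {ι q Ω β : Type*} [Fintype ι] [DecidableEq ι] [Fintype q] [DecidableEq q]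

/-- The affine manifold `{x : D x + b = 0}`. -/
def affineManifold (D : Matrix q ι ℝ) (b : q → ℝ) : Set (ι → ℝ) :=
  {x | D.mulVec x + b = 0}

/-- Manifold `μ`-adjacency. The embedding `d` enumerates the set `d_j` of `q` columns for which
the square matrix `D_{d_j}` is nonsingular; the subtype `{k // k ∉ Set.range d}` is the
complementary set `-d_j`. -/
def ManifoldAdj (D : Matrix q ι ℝ) (μ : ℝ) (x x' : ι → ℝ) : Prop :=
  ∃ d : q ↪ ι, IsUnit (D.submatrix id d).det ∧
    ∃ i, i ∉ Set.range d ∧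
      |x i - x' i| ≤ μ ∧
      (∀ k, k ∉ Set.range d → k ≠ i → x k = x' k) ∧
      (fun a : q => x (d a) - x' (d a)) =
        -((D.submatrix id d)⁻¹ * D.submatrix id
            (Subtype.val : {k // k ∉ Set.range d} → ι)).mulVec
          (fun k => x k - x' k)

/-- `(ε, δ)`-differential privacy, over the affine manifold `{x : D x + b = 0}` and under
manifold `μ`-adjacency, of the randomized mechanism `M`. -/
def DiffPrivateOver [MeasurableSpace Ω] [MeasurableSpace β] (P : Measure Ω)
    (M : (ι → ℝ) → Ω → β) (D : Matrix q ι ℝ) (b : q → ℝ) (μ ε δ : ℝ) : Prop :=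
  ∀ x ∈ affineManifold D b, ∀ x' ∈ affineManifold D b, ManifoldAdj D μ x x' →
    ∀ R : Set β, MeasurableSet R →
      P.real {ω | M x ω ∈ R} ≤ Real.exp ε * P.real {ω | M x' ω ∈ R} + δ

end Manifold

/-- The mechanism `x ↦ F x + γ`. -/
def linearMechanism {ι κ Ω : Type*} [Fintype ι] (F : Matrix κ ι ℝ) (γ : Ω → κ → ℝ)
    (x : ι → ℝ) (ω : Ω) : κ → ℝ :=
  F.mulVec x + γ ω

/-! ### The average consensus algorithm -/

section Consensus

variable {V : Type*}

/-- Admissible edge weights on the undirected communication graph `G`. -/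
structure IsConsensusWeight [Fintype V] (G : SimpleGraph V) (w : V → V → ℝ) : Prop where
  symm : ∀ i j, w i j = w j i
  pos : ∀ i j, G.Adj i j → 0 < w i j
  zero : ∀ i j, ¬ G.Adj i j → w i j = 0
  sum_lt_one : ∀ i, ∑ j, w i j < 1

/-- The control input `u_i = ∑_j w_ij (y_j - y_i)` computed from the messages `y` of one step. -/
def ctrlInput [Fintype V] (w : V → V → ℝ) (y : V → ℝ) (i : V) : ℝ :=
  ∑ j, w i j * (y j - y i)

/-- The node states `x_i(t)` of the algorithm with initial states `x0` and noises `γ i t`. -/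
def state [Fintype V] (w : V → V → ℝ) (γ : V → ℕ → ℝ) (x0 : V → ℝ) : ℕ → V → ℝ
  | 0 => x0
  | t + 1 => fun i =>
      state w γ x0 t i + ctrlInput w (fun j => state w γ x0 t j + γ j t) i

/-- The communication messages `y_i(t) = x_i(t) + γ_i(t)` of the algorithm. -/
def message [Fintype V] (w : V → V → ℝ) (γ : V → ℕ → ℝ) (x0 : V → ℝ) (t : ℕ) (i : V) : ℝ :=
  state w γ x0 t i + γ i t

/-- The noise which is constant in time at each node: `γ_i(t) = σ_i η_i`. -/
def constNoise {Ω : Type*} (σ : V → ℝ) (η : V → Ω → ℝ) (ω : Ω) (i : V) (_t : ℕ) : ℝ :=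
  σ i * η i ω

/-- The bidiagonal matrix with rows `(…, 1, -1, …)` that encodes the dynamics of one node over
the running steps `0, …, m`. -/
def nodeD (m : ℕ) : Matrix (Fin m) (Fin (m + 1)) ℝ :=
  fun s t => if t = s.castSucc then 1 else if t = s.succ then -1 else 0

variable (V) in
/-- The constraint matrix of all node state trajectories, one copy of `nodeD m` per node. -/
def stackedD [DecidableEq V] (m : ℕ) : Matrix (Fin m × V) (Fin (m + 1) × V) ℝ :=
  Matrix.blockDiagonal (fun _ : V => nodeD m)

/-- The control inputs `u_i(0), …, u_i(m - 1)` of all nodes as a function of a record `y` of the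
messages. -/
def inputs [Fintype V] {m : ℕ} (w : V → V → ℝ) (y : Fin (m + 1) × V → ℝ) : Fin m × V → ℝ :=
  fun p => ctrlInput w (fun j => y (p.1.castSucc, j)) p.2

/-- The mechanism `x ↦ x + γ` on the stacked state trajectories over the steps `0, …, m`. -/
def trajectoryMechanism [Fintype V] [DecidableEq V] {Ω : Type*} (m : ℕ) (γ : Ω → V → ℕ → ℝ) :
    (Fin (m + 1) × V → ℝ) → Ω → (Fin (m + 1) × V → ℝ) :=
  linearMechanism (1 : Matrix (Fin (m + 1) × V) (Fin (m + 1) × V) ℝ)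
    (fun ω p => γ ω p.2 p.1)

/-- All messages sent over the steps `0, …, m` when the algorithm is actually run in closed loop
from the initial states `x_i(0)` of the trajectory `x`. A state trajectory on the manifold with
`b = inputs w y` is determined by its initial states and the message record `y`. -/
def closedLoopMechanism [Fintype V] {Ω : Type*} (m : ℕ) (w : V → V → ℝ) (γ : Ω → V → ℕ → ℝ)
    (x : Fin (m + 1) × V → ℝ) (ω : Ω) : Fin (m + 1) × V → ℝ :=
  fun p => message w (γ ω) (fun i => x (0, i)) p.1 p.2

end Consensus

end

end AffineDP

/-! Since the noise is constant in time, both the perturbed trajectory (for fixed inputs `b`) and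
the closed-loop messages are deterministic functions of the initial messages `x_i(0) + γ_i`. Two
trajectories on the same manifold differ by a kernel vector of `D`, which is constant in time, and
nonsingularity of `D_d` leaves a free coordinate in the block of every node; so adjacent
trajectories have initial states that differ at a single node, by at most `μ`. By independence and
post-processing, privacy reduces to that of a scalar shift of the noise of one node. For Gaussian
noise the worst event is a half-line by Neyman–Pearson, with excess mass `κ(ε, s)` at shift `s`;
for Laplace noise the ratio of the densities is at most `e^ε` by the triangle inequality. -/

namespace AffineDP

open Filter Topology
open scoped ENNReal NNReal

section Indistinguishable

variable {α β : Type*} [MeasurableSpace α] [MeasurableSpace β] {ε δ : ℝ} {μ ν : Measure α}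

/-- `(ε, δ)`-indistinguishability of two laws, in the direction `μ ≤ e^ε ν + δ`: a mechanism is
`(ε, δ)`-differentially private when its output laws at adjacent inputs are indistinguishable. -/
def Indistinguishable (ε δ : ℝ) (μ ν : Measure α) : Prop :=
  ∀ R, MeasurableSet R → μ.real R ≤ Real.exp ε * ν.real R + δ

theorem Indistinguishable.nonneg (h : Indistinguishable ε δ μ ν) : 0 ≤ δ := by
  simpa using h ∅ .empty

theorem Indistinguishable.refl (hε : 0 ≤ ε) (hδ : 0 ≤ δ) (μ : Measure α) :
    Indistinguishable ε δ μ μ := fun _ _ =>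
  (le_mul_of_one_le_left measureReal_nonneg (Real.one_le_exp hε)).trans (le_add_of_nonneg_right hδ)

theorem Indistinguishable.mono {δ' : ℝ} (h : Indistinguishable ε δ μ ν) (hδ : δ ≤ δ') :
    Indistinguishable ε δ' μ ν := fun R hR =>
  (h R hR).trans (by gcongr)

theorem Indistinguishable.map (h : Indistinguishable ε δ μ ν) {f : α → β} (hf : Measurable f) :
    Indistinguishable ε δ (μ.map f) (ν.map f) := fun R hR => by
  rw [map_measureReal_apply hf hR, map_measureReal_apply hf hR]
  exact h _ (hf hR)

theorem indistinguishable_iff_measure_le [IsFiniteMeasure μ] [IsFiniteMeasure ν] (hδ : 0 ≤ δ) :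
    Indistinguishable ε δ μ ν ↔ ∀ R, MeasurableSet R →
      μ R ≤ ENNReal.ofReal (Real.exp ε) * ν R + ENNReal.ofReal δ := by
  refine forall₂_congr fun R _ => ?_
  rw [← ofReal_measureReal (μ := μ), ← ofReal_measureReal (μ := ν),
    ← ENNReal.ofReal_mul (Real.exp_pos ε).le, ← ENNReal.ofReal_add (by positivity) hδ,
    ENNReal.ofReal_le_ofReal_iff (by positivity)]

end Indistinguishable

section Product

variable {ι : Type*} {X : ι → Type*} [∀ i, MeasurableSpace (X i)]
  {μ ν : ∀ i, Measure (X i)}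

theorem lmarginal_congr_measure [DecidableEq ι] {s : Finset ι} (h : ∀ i ∈ s, μ i = ν i)
    (f : (∀ i, X i) → ℝ≥0∞) : ∫⋯∫⁻_s, f ∂μ = ∫⋯∫⁻_s, f ∂ν := by
  have hμν : (fun i : s => μ i) = fun i : s => ν i := funext fun i => h i i.2
  unfold lmarginal
  rw [hμν]

theorem pi_eq_lmarginal_erase [Fintype ι] [DecidableEq ι] [∀ i, SigmaFinite (μ i)]
    {S : Set (∀ i, X i)} (hS : MeasurableSet S) (k : ι) (x : ∀ i, X i) :
    Measure.pi μ S =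
      (∫⋯∫⁻_Finset.univ.erase k, (fun z => μ k (Function.update z k ⁻¹' S)) ∂μ) x := by
  have hslice (z : ∀ i, X i) :
      ∫⁻ t, S.indicator 1 (Function.update z k t) ∂μ k = μ k (Function.update z k ⁻¹' S) :=
    lintegral_indicator_one (measurable_update z hS)
  rw [← lintegral_indicator_one hS, lintegral_eq_lmarginal_univ x,
    lmarginal_erase' _ (measurable_one.indicator hS) (Finset.mem_univ k)]
  simp only [hslice]

theorem Indistinguishable.pi [Fintype ι] [∀ i, IsProbabilityMeasure (μ i)]
    [∀ i, IsProbabilityMeasure (ν i)] {ε δ : ℝ} {k : ι}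
    (hk : Indistinguishable ε δ (μ k) (ν k)) (h : ∀ i ≠ k, μ i = ν i) :
    Indistinguishable ε δ (Measure.pi μ) (Measure.pi ν) := by
  classical
  have hδ := hk.nonneg
  rw [indistinguishable_iff_measure_le hδ] at hk ⊢
  intro S hS
  have x : ∀ i, X i := fun i => (nonempty_of_isProbabilityMeasure (μ i)).some
  calc Measure.pi μ S
      = (∫⋯∫⁻_Finset.univ.erase k, (fun z => μ k (Function.update z k ⁻¹' S)) ∂ν) x := by
        rw [pi_eq_lmarginal_erase hS k x,
          lmarginal_congr_measure fun i hi => h i (Finset.ne_of_mem_erase hi)]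
    _ ≤ (∫⋯∫⁻_Finset.univ.erase k, (fun z => ENNReal.ofReal (Real.exp ε) *
          ν k (Function.update z k ⁻¹' S) + ENNReal.ofReal δ) ∂ν) x :=
        lmarginal_mono (fun z => hk _ (measurable_update z hS)) x
    _ = ENNReal.ofReal (Real.exp ε) * Measure.pi ν S + ENNReal.ofReal δ := by
        rw [pi_eq_lmarginal_erase hS k x]
        simp only [lmarginal]
        rw [lintegral_add_right _ measurable_const, lintegral_const_mul' _ _ ENNReal.ofReal_ne_top,
          lintegral_const, measure_univ, mul_one]

theorem indistinguishable_map_add_single {Ω V : Type*} [Finite V] [DecidableEq V]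
    [MeasurableSpace Ω] {P : Measure Ω} [IsProbabilityMeasure P] {γ : V → Ω → ℝ}
    (hγ : ∀ i, AEMeasurable (γ i) P) (hindep : iIndepFun γ P) {ε δ c : ℝ} {k : V}
    (h : Indistinguishable ε δ ((P.map (γ k)).map (· + c)) (P.map (γ k))) :
    Indistinguishable ε δ (P.map fun ω i => γ i ω + (Pi.single k c : V → ℝ) i)
      (P.map fun ω i => γ i ω) := by
  have := Fintype.ofFinite V
  have hγc (i : V) : AEMeasurable (fun ω => γ i ω + (Pi.single k c : V → ℝ) i) P :=
    (hγ i).add_const _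
  have hindepc : iIndepFun (fun i ω => γ i ω + (Pi.single k c : V → ℝ) i) P :=
    hindep.comp (fun i z => z + (Pi.single k c : V → ℝ) i) fun i => measurable_add_const _
  have (i : V) := Measure.isProbabilityMeasure_map (hγ i)
  have (i : V) := Measure.isProbabilityMeasure_map (hγc i)
  rw [hindep.map_fun_eq_pi_map hγ, hindepc.map_fun_eq_pi_map hγc]
  refine Indistinguishable.pi (k := k) ?_ fun i hi => by simp [hi]
  rw [AEMeasurable.map_map_of_aemeasurable (by fun_prop) (hγ k)] at h
  simpa [Function.comp_def] using h

end Product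

/-- Differential privacy of the scalar additive-noise mechanism `v ↦ v + z`, `z ∼ ν`, whose inputs
are adjacent when they are at distance at most `r`. -/
def IsShiftPrivate (ν : Measure ℝ) (r ε δ : ℝ) : Prop :=
  ∀ c, |c| ≤ r → Indistinguishable ε δ (ν.map (· + c)) ν

theorem IsShiftPrivate.map_const_mul {Ω : Type*} [MeasurableSpace Ω] {P : Measure Ω} {X : Ω → ℝ}
    (hX : Measurable X) {r ε δ s μ : ℝ} (h : IsShiftPrivate (P.map X) r ε δ) (hs : s ≠ 0)
    (hμ : μ ≤ |s| * r) : IsShiftPrivate (P.map fun ω => s * X ω) μ ε δ := by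
  intro c hc
  have hcs : |c / s| ≤ r := by
    rw [abs_div, div_le_iff₀' (abs_pos.2 hs)]
    exact hc.trans hμ
  have hscaled := (h _ hcs).map (measurable_const_mul s)
  rw [Measure.map_map (by fun_prop) hX, Measure.map_map (by fun_prop) (by fun_prop),
    Measure.map_map (by fun_prop) hX] at hscaled
  rw [Measure.map_map (by fun_prop) (by fun_prop)]
  simpa only [Function.comp_def, mul_add, mul_div_cancel₀ c hs] using hscaled

section Kappa

theorem gaussianReal_real_eq_integral (m : ℝ) {v : ℝ≥0} (hv : v ≠ 0) (A : Set ℝ) :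
    (gaussianReal m v).real A = ∫ z in A, gaussianPDFReal m v z := by
  rw [measureReal_def, gaussianReal_apply_eq_integral m hv,
    ENNReal.toReal_ofReal (integral_nonneg fun z => gaussianPDFReal_nonneg m v z)]

theorem continuous_gaussianPDFReal (m : ℝ) (v : ℝ≥0) : Continuous (gaussianPDFReal m v) := by
  unfold gaussianPDFReal
  fun_prop

theorem hasDerivAt_Phi (v : ℝ) : HasDerivAt Phi (gaussianPDFReal 0 1 v) v := by
  have hint := integrable_gaussianPDFReal 0 1
  have hcont := continuous_gaussianPDFReal 0 1
  have hPhi (u : ℝ) : Phi u = ∫ z in Set.Iic u, gaussianPDFReal 0 1 z := by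
    rw [Phi, cdf_eq_real, gaussianReal_real_eq_integral 0 one_ne_zero]
  have hPhi_eq : Phi = fun u => (∫ z in (0 : ℝ)..u, gaussianPDFReal 0 1 z) + Phi 0 := by
    ext u
    rw [hPhi, hPhi, ← intervalIntegral.integral_Iic_sub_Iic hint.integrableOn hint.integrableOn,
      sub_add_cancel]
  rw [hPhi_eq]
  exact (intervalIntegral.integral_hasDerivAt_right hint.intervalIntegrable
    (hcont.stronglyMeasurableAtFilter _ _) hcont.continuousAt).add_const _

theorem exp_mul_gaussianPDFReal (x : ℝ) {y : ℝ} (hy : y ≠ 0) :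
    Real.exp x * gaussianPDFReal 0 1 (-(y / 2) - x / y) = gaussianPDFReal 0 1 (y / 2 - x / y) := by
  simp only [gaussianPDFReal, NNReal.coe_one]
  rw [mul_left_comm, ← Real.exp_add]
  congr 2
  field_simp
  ring

theorem hasDerivAt_kappa (x : ℝ) {y : ℝ} (hy : y ≠ 0) :
    HasDerivAt (kappa x) (gaussianPDFReal 0 1 (y / 2 - x / y)) y := by
  have hhalf : HasDerivAt (fun y : ℝ => y / 2) (1 / 2) y := (hasDerivAt_id y).div_const 2
  have hdiv : HasDerivAt (fun y : ℝ => x / y) (-x / y ^ 2) y := by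
    refine ((hasDerivAt_const y x).div (hasDerivAt_id y) hy).congr_deriv ?_
    simp
  have hupper := (hasDerivAt_Phi _).comp y (hhalf.sub hdiv)
  have hlower := ((hasDerivAt_Phi _).comp y (hhalf.neg.sub hdiv)).const_mul (Real.exp x)
  refine (hupper.sub hlower).congr_deriv ?_
  simp only [Pi.sub_apply, Pi.neg_apply]
  rw [← mul_assoc, exp_mul_gaussianPDFReal x hy]
  ring

theorem continuousOn_kappa (x : ℝ) : ContinuousOn (kappa x) (Set.Ioi 0) := fun _ hy =>
  (hasDerivAt_kappa x (ne_of_gt hy)).continuousAt.continuousWithinAt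

theorem monotoneOn_kappa (x : ℝ) : MonotoneOn (kappa x) (Set.Ioi 0) := by
  refine monotoneOn_of_hasDerivWithinAt_nonneg (f' := fun y => gaussianPDFReal 0 1 (y / 2 - x / y))
    (convex_Ioi 0) (continuousOn_kappa x) (fun y hy => ?_) fun y _ => gaussianPDFReal_nonneg _ _ _
  rw [interior_Ioi] at hy
  exact (hasDerivAt_kappa x (ne_of_gt hy)).hasDerivWithinAt

theorem tendsto_kappa_nhdsGT_zero {x : ℝ} (hx : 0 < x) : Tendsto (kappa x) (𝓝[>] 0) (𝓝 0) := by
  have hdiv : Tendsto (fun y : ℝ => -(x / y)) (𝓝[>] 0) atBot := by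
    simp only [div_eq_mul_inv]
    exact tendsto_neg_atTop_atBot.comp (tendsto_inv_nhdsGT_zero.const_mul_atTop hx)
  have hhalf : Tendsto (fun y : ℝ => y / 2) (𝓝[>] 0) (𝓝 0) :=
    (Continuous.tendsto' (by fun_prop) 0 0 (by simp)).mono_left nhdsWithin_le_nhds
  have hPhi : Tendsto Phi atBot (𝓝 0) := tendsto_cdf_atBot _
  have hupper := hPhi.comp (hhalf.add_atBot hdiv)
  have hlower := (hPhi.comp (hhalf.neg.add_atBot hdiv)).const_mul (Real.exp x)
  have hlim := hupper.sub hlower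
  simp only [mul_zero, sub_zero] at hlim
  exact hlim

theorem tendsto_kappa_atTop (x : ℝ) : Tendsto (kappa x) atTop (𝓝 1) := by
  have hdiv : Tendsto (fun y : ℝ => -(x / y)) atTop (𝓝 (-0)) :=
    (tendsto_const_nhds.div_atTop tendsto_id).neg
  have hhalf : Tendsto (fun y : ℝ => y / 2) atTop atTop := tendsto_id.atTop_div_const two_pos
  have hupper := (tendsto_cdf_atTop (gaussianReal 0 1)).comp (hhalf.atTop_add hdiv)
  have hlower := ((tendsto_cdf_atBot (gaussianReal 0 1)).comp
    ((tendsto_neg_atTop_atBot.comp hhalf).atBot_add hdiv)).const_mul (Real.exp x)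
  have hlim := hupper.sub hlower
  simp only [mul_zero, sub_zero] at hlim
  exact hlim

theorem mem_image_kappa {x d : ℝ} (hx : 0 < x) (hd : 0 < d) (hd1 : d < 1) :
    d ∈ kappa x '' Set.Ioi 0 :=
  isPreconnected_Ioi.intermediate_value_Ioo (l₁ := 𝓝[>] 0) (l₂ := atTop) inf_le_right
    (le_principal_iff.2 (Ioi_mem_atTop 0)) (continuousOn_kappa x) (tendsto_kappa_nhdsGT_zero hx)
    (tendsto_kappa_atTop x) ⟨hd, hd1⟩

theorem kappaInv_pos {x d : ℝ} (hx : 0 < x) (hd : 0 < d) (hd1 : d < 1) : 0 < kappaInv x d :=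
  Function.invFunOn_mem (mem_image_kappa hx hd hd1)

theorem kappa_kappaInv {x d : ℝ} (hx : 0 < x) (hd : 0 < d) (hd1 : d < 1) :
    kappa x (kappaInv x d) = d :=
  Function.invFunOn_eq (mem_image_kappa hx hd hd1)

end Kappa

section Gaussian

theorem gaussianPDFReal_eq_exp_mul (m : ℝ) (v : ℝ≥0) (z : ℝ) :
    gaussianPDFReal m v z = Real.exp ((m * z - m ^ 2 / 2) / v) * gaussianPDFReal 0 v z := by
  simp only [gaussianPDFReal]
  rw [mul_left_comm, ← Real.exp_add]
  congr 2
  ring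

theorem gaussianReal_real_Ici (m u : ℝ) : (gaussianReal m 1).real (Set.Ici u) = Phi (m - u) := by
  have hmap : (gaussianReal 0 1).map (m - ·) = gaussianReal m 1 := by
    rw [gaussianReal_map_const_sub, sub_zero]
  rw [Phi, cdf_eq_real, ← hmap, map_measureReal_apply (by fun_prop) measurableSet_Ici]
  congr 1
  ext z
  exact le_sub_comm (a := u) (b := m) (c := z)

theorem exp_mul_gaussianPDFReal_le_iff {s : ℝ} (hs : 0 < s) (ε z : ℝ) :
    Real.exp ε * gaussianPDFReal 0 1 z ≤ gaussianPDFReal s 1 z ↔ s / 2 + ε / s ≤ z := by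
  have hthreshold : s * (s / 2 + ε / s) = ε + s ^ 2 / 2 := by
    field_simp
    ring
  rw [gaussianPDFReal_eq_exp_mul s, mul_le_mul_iff_left₀ (gaussianPDFReal_pos _ _ _ one_ne_zero),
    Real.exp_le_exp, NNReal.coe_one, div_one, le_sub_iff_add_le, ← hthreshold,
    mul_le_mul_iff_right₀ hs]

-- Neyman–Pearson: the excess of mass over `e^ε` times the other law is largest on the half-line
-- where the excess density is nonnegative.
theorem indistinguishable_gaussianReal_of_pos {s : ℝ} (hs : 0 < s) (ε : ℝ) :
    Indistinguishable ε (kappa ε s) (gaussianReal s 1) (gaussianReal 0 1) := by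
  let excess : ℝ → ℝ := fun z => gaussianPDFReal s 1 z - Real.exp ε * gaussianPDFReal 0 1 z
  have hint_s := integrable_gaussianPDFReal s 1
  have hint_zero := (integrable_gaussianPDFReal 0 1).const_mul (Real.exp ε)
  have hexcess (A : Set ℝ) : ∫ z in A, excess z =
      (gaussianReal s 1).real A - Real.exp ε * (gaussianReal 0 1).real A := by
    rw [integral_sub hint_s.integrableOn hint_zero.integrableOn, integral_const_mul,
      gaussianReal_real_eq_integral s one_ne_zero, gaussianReal_real_eq_integral 0 one_ne_zero]
  have hnonneg : {z | 0 ≤ excess z} = Set.Ici (s / 2 + ε / s) := by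
    ext z
    exact sub_nonneg.trans (exp_mul_gaussianPDFReal_le_iff hs ε z)
  have hkappa : ∫ z in Set.Ici (s / 2 + ε / s), excess z = kappa ε s := by
    rw [hexcess, gaussianReal_real_Ici, gaussianReal_real_Ici, kappa]
    ring_nf
  intro R hR
  have hmax : ∫ z in R, excess z ≤ kappa ε s := by
    rw [← hkappa, ← hnonneg]
    exact setIntegral_le_nonneg hR (by fun_prop) (hint_s.sub hint_zero)
  rw [hexcess] at hmax
  linarith

theorem isShiftPrivate_gaussianReal {ε δ : ℝ} (hε : 0 < ε) (hδ : 0 < δ) (hδ1 : δ < 1) :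
    IsShiftPrivate (gaussianReal 0 1) (kappaInv ε δ) ε δ := by
  have hpos {s : ℝ} (hs : 0 < s) (hle : s ≤ kappaInv ε δ) :
      Indistinguishable ε δ (gaussianReal s 1) (gaussianReal 0 1) :=
    (indistinguishable_gaussianReal_of_pos hs ε).mono <|
      (monotoneOn_kappa ε hs (kappaInv_pos hε hδ hδ1) hle).trans_eq (kappa_kappaInv hε hδ hδ1)
  intro c hc
  rw [gaussianReal_map_add_const, zero_add]
  rcases lt_trichotomy c 0 with hneg | rfl | hc0
  · rw [abs_of_neg hneg] at hc
    simpa [gaussianReal_map_neg] using (hpos (neg_pos.2 hneg) hc).map measurable_neg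
  · exact .refl hε.le hδ.le _
  · exact hpos hc0 ((le_abs_self c).trans hc)

theorem isShiftPrivate_map_const_mul_of_gaussianReal {Ω : Type*} [MeasurableSpace Ω]
    {P : Measure Ω} {X : Ω → ℝ} (hX : Measurable X) (hlaw : P.map X = gaussianReal 0 1)
    {ε δ μ s : ℝ} (hε : 0 < ε) (hδ : 0 < δ) (hδ1 : δ < 1) (hμ : 0 < μ)
    (hs : μ ^ 2 / kappaInv ε δ ^ 2 ≤ s ^ 2) : IsShiftPrivate (P.map fun ω => s * X ω) μ ε δ := by
  have hκ := kappaInv_pos hε hδ hδ1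
  have hle : μ / kappaInv ε δ ≤ |s| := by
    rw [← div_pow] at hs
    exact (le_abs_self _).trans (sq_le_sq.1 hs)
  exact .map_const_mul hX (hlaw ▸ isShiftPrivate_gaussianReal hε hδ hδ1)
    (abs_pos.1 ((div_pos hμ hκ).trans_le hle)) ((div_le_iff₀ hκ).1 hle)

end Gaussian

section Laplace

theorem map_add_right_withDensity_le {G : Type*} [AddGroup G] [MeasurableSpace G]
    [MeasurableAdd G] (ρ : Measure G) [ρ.IsAddRightInvariant] {f : G → ℝ≥0∞} (hf : Measurable f)
    {a : ℝ≥0∞} {c : G} (h : ∀ v, f v ≤ a * f (v + c)) :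
    (ρ.withDensity f).map (· + c) ≤ a • ρ.withDensity f := by
  refine Measure.le_iff.2 fun B hB => ?_
  have hBc : MeasurableSet ((· + c) ⁻¹' B) := measurable_add_const c hB
  rw [Measure.map_apply (measurable_add_const c) hB, withDensity_apply _ hBc,
    Measure.smul_apply, smul_eq_mul, withDensity_apply _ hB]
  calc ∫⁻ v in (· + c) ⁻¹' B, f v ∂ρ
      ≤ ∫⁻ v in (· + c) ⁻¹' B, a * f (v + c) ∂ρ := lintegral_mono h
    _ = a * ∫⁻ v in (· + c) ⁻¹' B, f (v + c) ∂ρ :=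
        lintegral_const_mul _ (hf.comp (measurable_add_const c))
    _ = a * ∫⁻ v in B, f v ∂ρ := by
        rw [(measurePreserving_add_right ρ c).setLIntegral_comp_preimage hB hf]

theorem integrable_exp_neg_abs : Integrable fun v : ℝ => Real.exp (-|v|) := by
  rw [← integrableOn_univ, ← Set.Iic_union_Ioi (a := (0 : ℝ))]
  refine .union ((integrableOn_exp_Iic 0).congr_fun (fun v hv => ?_) measurableSet_Iic)
    ((integrableOn_exp_neg_Ioi 0).congr_fun (fun v hv => ?_) measurableSet_Ioi)
  · simp only [abs_of_nonpos (Set.mem_Iic.1 hv), neg_neg]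
  · simp only [abs_of_pos (Set.mem_Ioi.1 hv)]

theorem isFiniteMeasure_laplaceMeasure (m : ℝ) {s : ℝ} (hs : 0 < s) :
    IsFiniteMeasure (laplaceMeasure m s) := by
  have hint : Integrable fun v : ℝ => Real.exp (-|v - m| / s) := by
    have hcomp := (integrable_exp_neg_abs.comp_div hs.ne').comp_sub_right m
    refine hcomp.congr (.of_forall fun v => ?_)
    simp only [abs_div, abs_of_pos hs, neg_div]
  exact isFiniteMeasure_withDensity_ofReal (hint.const_mul _).hasFiniteIntegral

theorem isShiftPrivate_laplaceMeasure (m : ℝ) {s : ℝ} (hs : 0 < s) (ε : ℝ) :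
    IsShiftPrivate (laplaceMeasure m s) (s * ε) ε 0 := by
  intro c hc
  have := isFiniteMeasure_laplaceMeasure m hs
  have hdensity (v : ℝ) : ENNReal.ofReal ((2 * s)⁻¹ * Real.exp (-|v - m| / s)) ≤
      ENNReal.ofReal (Real.exp ε) *
        ENNReal.ofReal ((2 * s)⁻¹ * Real.exp (-|v + c - m| / s)) := by
    have htri : |v + c - m| ≤ |v - m| + |c| := by
      rw [add_sub_right_comm]
      exact abs_add_le _ _
    rw [← ENNReal.ofReal_mul (Real.exp_pos ε).le, mul_left_comm, ← Real.exp_add]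
    gcongr
    rw [div_le_iff₀ hs, add_mul, div_mul_cancel₀ _ hs.ne']
    linarith
  have hle := map_add_right_withDensity_le volume (by fun_prop) hdensity
  rw [indistinguishable_iff_measure_le le_rfl]
  exact fun R _ => (hle R).trans le_self_add

theorem isShiftPrivate_map_const_mul_of_laplaceMeasure {Ω : Type*} [MeasurableSpace Ω]
    {P : Measure Ω} {X : Ω → ℝ} (hX : Measurable X) (hlaw : P.map X = laplaceMeasure 0 1)
    {ε μ s : ℝ} (hε : 0 < ε) (hμ : 0 < μ) (hs : μ / ε ≤ s) :
    IsShiftPrivate (P.map fun ω => s * X ω) μ ε 0 := by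
  have hs0 : 0 < s := (div_pos hμ hε).trans_le hs
  refine .map_const_mul hX (hlaw ▸ isShiftPrivate_laplaceMeasure 0 one_pos ε) hs0.ne' ?_
  rw [one_mul, abs_of_pos hs0]
  exact (div_le_iff₀ hε).1 hs

end Laplace

section Manifold

theorem eq_zero_of_mulVec_eq_zero {q ι R : Type*} [Fintype q] [DecidableEq q] [Fintype ι]
    [CommRing R] {D : Matrix q ι R} {d : q ↪ ι} (hd : IsUnit (D.submatrix id d).det) {e : ι → R}
    (he : D.mulVec e = 0) (hsupp : ∀ p, p ∉ Set.range d → e p = 0) : e = 0 := by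
  have hed : (D.submatrix id d).mulVec (e ∘ d) = 0 := by
    rw [← he]
    ext a
    refine Finset.sum_of_injOn d d.injective.injOn (by simp) (fun p _ hp => ?_) fun _ _ => rfl
    rw [hsupp p (by simpa using hp), mul_zero]
  have hzero : e ∘ d = 0 :=
    Matrix.mulVec_injective_of_isUnit ((Matrix.isUnit_iff_isUnit_det _).2 hd)
      (hed.trans (Matrix.mulVec_zero _).symm)
  ext p
  by_cases hp : p ∈ Set.range d
  · obtain ⟨a, rfl⟩ := hp
    exact congrFun hzero a
  · exact hsupp p hp

variable {V : Type*} [Fintype V] [DecidableEq V] {m : ℕ} {b : Fin m × V → ℝ}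
  {x x' : Fin (m + 1) × V → ℝ}

theorem stackedD_mulVec (v : Fin (m + 1) × V → ℝ) (s : Fin m) (i : V) :
    (stackedD V m).mulVec v (s, i) = v (s.castSucc, i) - v (s.succ, i) := by
  have hentry (t : Fin (m + 1)) : nodeD m s t =
      (if t = s.castSucc then 1 else 0) - (if t = s.succ then 1 else 0) := by
    have hne := s.castSucc_lt_succ.ne
    unfold nodeD
    grind
  simp [Matrix.mulVec, dotProduct, stackedD, Matrix.blockDiagonal_apply, Fintype.sum_prod_type,
    hentry, sub_mul, Finset.sum_sub_distrib]

theorem eq_add_partialSum_of_mem_affineManifold (hx : x ∈ affineManifold (stackedD V m) b)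
    (t : Fin (m + 1)) (i : V) :
    x (t, i) = x (0, i) + Fin.partialSum (fun s => b (s, i)) t := by
  induction t using Fin.induction with
  | zero => rw [Fin.partialSum_zero, add_zero]
  | succ s ih =>
    have hstep : x (s.castSucc, i) - x (s.succ, i) + b (s, i) = 0 := by
      rw [← stackedD_mulVec]
      exact congrFun hx (s, i)
    rw [Fin.partialSum_succ]
    linarith

theorem exists_notMem_range_of_isUnit_det {d : Fin m × V ↪ Fin (m + 1) × V}
    (hd : IsUnit ((stackedD V m).submatrix id d).det) (i : V) :
    ∃ t, (t, i) ∉ Set.range d := by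
  by_contra! hall
  let e : Fin (m + 1) × V → ℝ := fun p => if p.2 = i then 1 else 0
  have he : (stackedD V m).mulVec e = 0 := by
    ext ⟨s, j⟩
    rw [stackedD_mulVec, sub_self, Pi.zero_apply]
  have hsupp : ∀ p, p ∉ Set.range d → e p = 0 := by
    rintro ⟨t, j⟩ hp
    refine if_neg ?_
    rintro rfl
    exact hp (hall t)
  simpa [e] using congrFun (eq_zero_of_mulVec_eq_zero hd he hsupp) (0, i)

theorem exists_initial_eq_add_single_of_manifoldAdj {μ : ℝ}
    (hx : x ∈ affineManifold (stackedD V m) b) (hx' : x' ∈ affineManifold (stackedD V m) b)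
    (h : ManifoldAdj (stackedD V m) μ x x') :
    ∃ (k : V) (c : ℝ), |c| ≤ μ ∧ ∀ i, x (0, i) = x' (0, i) + (Pi.single k c : V → ℝ) i := by
  obtain ⟨d, hd, ⟨t₀, k⟩, -, hc, hfree, -⟩ := h
  have hconst (t : Fin (m + 1)) (i : V) : x (t, i) - x' (t, i) = x (0, i) - x' (0, i) := by
    rw [eq_add_partialSum_of_mem_affineManifold hx, eq_add_partialSum_of_mem_affineManifold hx',
      add_sub_add_right_eq_sub]
  refine ⟨k, x (0, k) - x' (0, k), hconst t₀ k ▸ hc, fun i => ?_⟩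
  rw [← sub_eq_iff_eq_add']
  rcases eq_or_ne i k with rfl | hik
  · rw [Pi.single_eq_same]
  · obtain ⟨t, ht⟩ := exists_notMem_range_of_isUnit_det hd i
    rw [Pi.single_eq_of_ne hik, ← hconst t, hfree (t, i) ht (by simp [hik]), sub_self]

end Manifold

section Consensus

variable {V Ω : Type*} [Fintype V]

/-- The map that sends the messages of one step of the closed loop to those of the next, when the
noise is constant in time. -/
def messageStep (w : V → V → ℝ) (y : V → ℝ) : V → ℝ :=
  fun i => y i + ctrlInput w y i

theorem measurable_messageStep (w : V → V → ℝ) : Measurable (messageStep w) := by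
  unfold messageStep ctrlInput
  fun_prop

theorem message_eq_iterate_messageStep (w : V → V → ℝ) (g x₀ : V → ℝ) (t : ℕ) :
    message w (fun i _ => g i) x₀ t = (messageStep w)^[t] fun i => x₀ i + g i := by
  induction t with
  | zero => rfl
  | succ t ih =>
    rw [Function.iterate_succ_apply', ← ih]
    ext i
    exact add_right_comm _ _ _

variable [DecidableEq V] [MeasurableSpace Ω] {P : Measure Ω} [IsProbabilityMeasure P]
  {γ : V → Ω → ℝ} {ε δ μ : ℝ} {m : ℕ}

theorem diffPrivateOver_of_eq_comp_initial {β : Type*} [MeasurableSpace β]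
    (hγ : ∀ i, AEMeasurable (γ i) P) (hindep : iIndepFun γ P)
    (hpriv : ∀ i, IsShiftPrivate (P.map (γ i)) μ ε δ)
    {M : (Fin (m + 1) × V → ℝ) → Ω → β} {b : Fin m × V → ℝ} {F : (V → ℝ) → β} (hF : Measurable F)
    (hM : ∀ x ∈ affineManifold (stackedD V m) b, ∀ ω, M x ω = F fun i => x (0, i) + γ i ω) :
    DiffPrivateOver P M (stackedD V m) b μ ε δ := by
  intro x hx x' hx' hadj R hR
  obtain ⟨k, c, hc, hinit⟩ := exists_initial_eq_add_single_of_manifoldAdj hx hx' hadj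
  have hmeas : Measurable fun (g : V → ℝ) => F fun i => x' (0, i) + g i := by fun_prop
  have h := indistinguishable_map_add_single hγ hindep (hpriv k c hc) _ (hmeas hR)
  rw [map_measureReal_apply_of_aemeasurable (by fun_prop) (hmeas hR),
    map_measureReal_apply_of_aemeasurable (by fun_prop) (hmeas hR)] at h
  simp only [hM x hx, hM x' hx', hinit, add_assoc, add_comm (Pi.single _ _ _)]
  exact h

end Consensus

end AffineDP

open AffineDP in
theorem theorem4_general {V Ω : Type*} [Fintype V] [DecidableEq V] (w : V → V → ℝ)
    [MeasurableSpace Ω] {P : Measure Ω} [IsProbabilityMeasure P]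
    {γ : V → Ω → ℝ} (hγ : ∀ i, AEMeasurable (γ i) P) (hindep : iIndepFun γ P)
    {ε δ μ : ℝ} (hpriv : ∀ i, IsShiftPrivate (P.map (γ i)) μ ε δ) (m : ℕ) :
    (∀ b : Fin m × V → ℝ,
      DiffPrivateOver P (trajectoryMechanism m fun ω i _ => γ i ω) (stackedD V m) b μ ε δ) ∧
    (∀ y : Fin (m + 1) × V → ℝ,
      DiffPrivateOver P (closedLoopMechanism m w fun ω i _ => γ i ω)
        (stackedD V m) (inputs w y) μ ε δ) := by
  constructor
  · intro b
    let replay (z : V → ℝ) (p : Fin (m + 1) × V) := z p.2 + Fin.partialSum (fun s => b (s, p.2)) p.1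
    refine diffPrivateOver_of_eq_comp_initial hγ hindep hpriv (F := replay) (by fun_prop) ?_
    intro x hx ω
    ext ⟨t, i⟩
    simp only [trajectoryMechanism, linearMechanism, Matrix.one_mulVec, Pi.add_apply, replay,
      eq_add_partialSum_of_mem_affineManifold hx t]
    exact add_right_comm _ _ _
  · intro y
    let run (z : V → ℝ) (p : Fin (m + 1) × V) := (messageStep w)^[p.1] z p.2
    have hrun : Measurable run := measurable_pi_lambda _ fun p =>
      (measurable_pi_apply p.2).comp ((measurable_messageStep w).iterate p.1)
    refine diffPrivateOver_of_eq_comp_initial hγ hindep hpriv hrun fun x _ ω => ?_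
    ext p
    exact congrFun (message_eq_iterate_messageStep w _ _ p.1) p.2

open AffineDP in
theorem theorem4 {V Ω : Type*} [Fintype V] [DecidableEq V]
    (G : SimpleGraph V) (hG : G.Connected) (w : V → V → ℝ) (hw : IsConsensusWeight G w)
    [MeasurableSpace Ω] (P : Measure Ω) [IsProbabilityMeasure P]
    (η : V → Ω → ℝ) (hη : ∀ i, Measurable (η i)) (hindep : iIndepFun η P)
    (σ : V → ℝ) (ε δ μ : ℝ) (hε : 0 < ε) (hμ : 0 < μ)
    (hcase :
      ((0 < δ ∧ δ < 1) ∧ (∀ i, P.map (η i) = gaussianReal 0 1) ∧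
          ∀ i, σ i ^ 2 ≥ μ ^ 2 / (kappaInv ε δ) ^ 2) ∨
      (δ = 0 ∧ (∀ i, P.map (η i) = laplaceMeasure 0 1) ∧ ∀ i, σ i ≥ μ / ε))
    (m : ℕ) :
    (∀ b : Fin m × V → ℝ,
      DiffPrivateOver P (trajectoryMechanism m (constNoise σ η)) (stackedD V m) b μ ε δ) ∧
    (∀ y : Fin (m + 1) × V → ℝ,
      DiffPrivateOver P (closedLoopMechanism m w (constNoise σ η))
        (stackedD V m) (inputs w y) μ ε δ) := by
  refine theorem4_general w (fun i => ((hη i).const_mul (σ i)).aemeasurable)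
    (hindep.comp _ fun i => measurable_const_mul (σ i)) (fun i => ?_) m
  rcases hcase with ⟨⟨hδ, hδ1⟩, hlaw, hσ⟩ | ⟨rfl, hlaw, hσ⟩
  · exact isShiftPrivate_map_const_mul_of_gaussianReal (hη i) (hlaw i) hε hδ hδ1 hμ (hσ i)
  · exact isShiftPrivate_map_const_mul_of_laplaceMeasure (hη i) (hlaw i) hε hμ (hσ i)
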